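/- Let $m\in\mathbb N$ and let $A=\{A(k)\}_{k\in\mathbb Z}$, $B=\{B(k)\}_{k\in\mathbb Z}$ be sequences of complex self-adjoint $m\times m$ matrices with every $A(k)$ positive definite and $\sup_{k}(\|A(k)\|+\|B(k)\|)<\infty$. The associated Jacobi operator $H$ is the bounded operator on $\ell^2(\mathbb Z)^m$ given by $$(Hf)(k)=A(k)f(k+1)+A(k-1)f(k-1)+B(k)f(k),\qquad k\in\mathbb Z.$$ Fix $k_0\in\mathbb Z$. For $z\in\mathbb C$ let $\theta(z,\cdot,k_0)$, $\phi(z,\cdot,k_0)$ be the $m\times m$ matrix-valued solutions of $$A(k)\psi(k+1)+A(k-1)\psi(k-1)+(B(k)-zI_m)\psi(k)=0,\qquad k\in\mathbb Z,$$ with $\theta(z,k_0,k_0)=\phi(z,k_0+1,k_0)=I_m$ and $\phi(z,k_0,k_0)=\theta(z,k_0+1,k_0)=0$. For $z\in\mathbb C\setminus\mathbb R$ let $M_\pm(z,k_0)$ be the unique $m\times m$ matrix for which $\theta(z,\cdot,k_0)-\phi(z,\cdot,k_0)A(k_0)^{-1}M_\pm(z,k_0)$ is square summable on $(k_0,\pm\infty)\cap\mathbb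 Z$, and (writing $M_\pm=M_\pm(z,k_0)$) define the $2m\times 2m$ Weyl–Titchmarsh matrix $$M(z,k_0)=\begin{pmatrix}[M_--M_+]^{-1} & \tfrac12[M_--M_+]^{-1}[M_-+M_+]\\ \tfrac12[M_-+M_+][M_--M_+]^{-1} & M_+[M_--M_+]^{-1}M_-\end{pmatrix}.$$ **Theorem 4.2.** $M(z,k_0)$ for all $z\in\mathbb C_+=\{z:\operatorname{Im}z>0\}$ uniquely determines $H$, and hence $A$ and $B$: if $(A_1,B_1)$ and $(A_2,B_2)$ are two pairs of sequences as above (with the same $m$), with Jacobi operators $H_1,H_2$ and Weyl–Titchmarsh matrices $M_1,M_2$, and $M_1(z,k_0)=M_2(z,k_0)$ for all $z\in\mathbb C_+$, then $H_1=H_2$, and $A_1(k)=A_2(k)$ and $B_1(k)=B_2(k)$ for all $k\in\mathbb Z$. -/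

import Mathlib

open scoped Matrix Matrix.Norms.L2Operator ComplexOrder

/-- Coefficients of a bounded matrix-valued Jacobi operator: two sequences of self-adjoint complex
`m × m` matrices indexed by `ℤ`, with `A k` positive definite, uniformly bounded in operator
norm. -/
structure JacobiCoeffs (m : ℕ) where
  A : ℤ → Matrix (Fin m) (Fin m) ℂ
  B : ℤ → Matrix (Fin m) (Fin m) ℂ
  A_posDef : ∀ k, (A k).PosDef
  B_selfAdjoint : ∀ k, (B k).IsHermitian
  bounded : ∃ C : ℝ, 0 < C ∧ ∀ k, ‖A k‖ + ‖B k‖ ≤ C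

/-- The Hilbert space `ℓ²(ℤ)^m`, realized as the square-summable sequences `ℤ → ℂ^m`. -/
abbrev EllTwo (m : ℕ) : Type := lp (fun _ : ℤ => EuclideanSpace ℂ (Fin m)) 2

namespace EllTwo

variable {m : ℕ}

theorem memlp_shift (j : ℤ) (f : EllTwo m) :
    Memℓp (fun k : ℤ => f (k + j)) 2 := by
  have hp : 0 < (2 : ENNReal).toReal := by norm_num
  have h := (lp.memℓp f).summable hp
  exact (memℓp_gen_iff hp).2 (h.comp_injective (add_left_injective j))

/-- The shift `(shift j f)(k) = f (k + j)` on `ℓ²(ℤ)^m`. -/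
noncomputable def shift (j : ℤ) : EllTwo m →L[ℂ] EllTwo m :=
  LinearMap.mkContinuous
    { toFun := fun f => ⟨fun k => f (k + j), memlp_shift j f⟩
      map_add' := fun _ _ => rfl
      map_smul' := fun _ _ => rfl }
    1
    (fun f => by
      have hp : 0 < (2 : ENNReal).toReal := by norm_num
      rw [one_mul]
      refine lp.norm_le_of_tsum_le hp (norm_nonneg f) ?_
      rw [lp.norm_rpow_eq_tsum hp f]
      exact ((Equiv.addRight j).tsum_eq (fun k => ‖f k‖ ^ (2 : ENNReal).toReal)).le)

/-- Multiplication of `f` by a uniformly bounded sequence of matrices, `k ↦ T k (f k)`. -/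
noncomputable def mulOp (T : ℤ → Matrix (Fin m) (Fin m) ℂ) {C : ℝ} (hC : 0 ≤ C)
    (hT : ∀ k, ‖T k‖ ≤ C) : EllTwo m →L[ℂ] EllTwo m :=
  lp.mapCLM 2 (fun k => Matrix.toEuclideanCLM (n := Fin m) (𝕜 := ℂ) (T k)) hC hT

theorem shift_apply (j : ℤ) (f : EllTwo m) (k : ℤ) : shift j f k = f (k + j) := rfl

theorem mulOp_apply (T : ℤ → Matrix (Fin m) (Fin m) ℂ) {C : ℝ} (hC : 0 ≤ C)
    (hT : ∀ k, ‖T k‖ ≤ C) (f : EllTwo m) (k : ℤ) :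
    (mulOp T hC hT f k).ofLp = T k *ᵥ (f k).ofLp := rfl

end EllTwo

namespace JacobiCoeffs

variable {m : ℕ} (J : JacobiCoeffs m)

/-- A uniform bound on the coefficients. -/
noncomputable def bound : ℝ := J.bounded.choose

theorem bound_nonneg : 0 ≤ J.bound := J.bounded.choose_spec.1.le

theorem norm_A_le (k : ℤ) : ‖J.A k‖ ≤ J.bound :=
  (le_add_of_nonneg_right (norm_nonneg _)).trans (J.bounded.choose_spec.2 k)

theorem norm_B_le (k : ℤ) : ‖J.B k‖ ≤ J.bound :=
  (le_add_of_nonneg_left (norm_nonneg _)).trans (J.bounded.choose_spec.2 k)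

/-- The Jacobi operator `H = A S⁺ + A⁻ S⁻ + B` as a bounded operator on all of `ℓ²(ℤ)^m`. -/
noncomputable def H : EllTwo m →L[ℂ] EllTwo m :=
  (EllTwo.mulOp J.A J.bound_nonneg J.norm_A_le).comp (EllTwo.shift 1)
    + (EllTwo.mulOp (fun k => J.A (k - 1)) J.bound_nonneg (fun k => J.norm_A_le (k - 1))).comp
        (EllTwo.shift (-1))
    + EllTwo.mulOp J.B J.bound_nonneg J.norm_B_le

theorem H_apply (f : EllTwo m) (k : ℤ) :
    (J.H f k).ofLp = J.A k *ᵥ (f (k + 1)).ofLp + J.A (k - 1) *ᵥ (f (k - 1)).ofLp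
      + J.B k *ᵥ (f k).ofLp := by
  simp [H, EllTwo.mulOp_apply, EllTwo.shift_apply, sub_eq_add_neg]

/-- `ψ` is an `m × m` matrix-valued solution of the Jacobi difference equation
`A(k) ψ(k+1) + A(k-1) ψ(k-1) + (B(k) - z) ψ(k) = 0`. -/
def IsSolution (z : ℂ) (ψ : ℤ → Matrix (Fin m) (Fin m) ℂ) : Prop :=
  ∀ k : ℤ, J.A k * ψ (k + 1) + J.A (k - 1) * ψ (k - 1)
    + (J.B k - z • (1 : Matrix (Fin m) (Fin m) ℂ)) * ψ k = 0

/-- `(ψ k, ψ (k + 1)) ↦ (ψ (k + 1), ψ (k + 2))` for solutions `ψ`. -/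
noncomputable def stepRight (z : ℂ) (k : ℤ)
    (P : Matrix (Fin m) (Fin m) ℂ × Matrix (Fin m) (Fin m) ℂ) :
    Matrix (Fin m) (Fin m) ℂ × Matrix (Fin m) (Fin m) ℂ :=
  (P.2, (J.A (k + 1))⁻¹ *
    ((z • (1 : Matrix (Fin m) (Fin m) ℂ) - J.B (k + 1)) * P.2 - J.A k * P.1))

/-- `(ψ k, ψ (k + 1)) ↦ (ψ (k - 1), ψ k)` for solutions `ψ`. -/
noncomputable def stepLeft (z : ℂ) (k : ℤ)
    (P : Matrix (Fin m) (Fin m) ℂ × Matrix (Fin m) (Fin m) ℂ) :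
    Matrix (Fin m) (Fin m) ℂ × Matrix (Fin m) (Fin m) ℂ :=
  ((J.A (k - 1))⁻¹ *
    ((z • (1 : Matrix (Fin m) (Fin m) ℂ) - J.B k) * P.1 - J.A k * P.2), P.1)

/-- The pair `(ψ (k₀ + n), ψ (k₀ + n + 1))` for the solution with `ψ k₀ = X`,
`ψ (k₀ + 1) = Y`. -/
noncomputable def pairRight (z : ℂ) (k₀ : ℤ) (X Y : Matrix (Fin m) (Fin m) ℂ) :
    ℕ → Matrix (Fin m) (Fin m) ℂ × Matrix (Fin m) (Fin m) ℂ
  | 0 => (X, Y)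
  | n + 1 => J.stepRight z (k₀ + n) (pairRight z k₀ X Y n)

/-- The pair `(ψ (k₀ - n), ψ (k₀ - n + 1))` for the solution with `ψ k₀ = X`,
`ψ (k₀ + 1) = Y`. -/
noncomputable def pairLeft (z : ℂ) (k₀ : ℤ) (X Y : Matrix (Fin m) (Fin m) ℂ) :
    ℕ → Matrix (Fin m) (Fin m) ℂ × Matrix (Fin m) (Fin m) ℂ
  | 0 => (X, Y)
  | n + 1 => J.stepLeft z (k₀ - n) (pairLeft z k₀ X Y n)

/-- The solution of the difference equation with `ψ k₀ = X` and `ψ (k₀ + 1) = Y`. -/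
noncomputable def sol (z : ℂ) (k₀ : ℤ) (X Y : Matrix (Fin m) (Fin m) ℂ) (k : ℤ) :
    Matrix (Fin m) (Fin m) ℂ :=
  if k₀ ≤ k then (J.pairRight z k₀ X Y (k - k₀).toNat).1
  else (J.pairLeft z k₀ X Y (k₀ - k).toNat).1

section sol

variable (z : ℂ) (k₀ : ℤ) (X Y : Matrix (Fin m) (Fin m) ℂ)

theorem sol_right (n : ℕ) : J.sol z k₀ X Y (k₀ + n) = (J.pairRight z k₀ X Y n).1 := by
  simp [sol]

theorem sol_left (n : ℕ) : J.sol z k₀ X Y (k₀ - n) = (J.pairLeft z k₀ X Y n).1 := by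
  rcases n with _ | n
  · simp [sol, pairRight, pairLeft]
  · have h1 : ¬ k₀ ≤ k₀ - ((n + 1 : ℕ) : ℤ) := by push_cast; omega
    have h2 : (k₀ - (k₀ - ((n + 1 : ℕ) : ℤ))).toNat = n + 1 := by push_cast; omega
    rw [sol, if_neg h1, h2]

theorem sol_self : J.sol z k₀ X Y k₀ = X := by
  simp [sol, pairRight]

theorem sol_succ : J.sol z k₀ X Y (k₀ + 1) = Y := by
  have h := J.sol_right z k₀ X Y 1
  simpa [pairRight, stepRight] using h

theorem A_mul_inv (k : ℤ) (P : Matrix (Fin m) (Fin m) ℂ) :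
    J.A k * ((J.A k)⁻¹ * P) = P :=
  Matrix.mul_nonsing_inv_cancel_left _ _
    ((Matrix.isUnit_iff_isUnit_det _).1 (J.A_posDef k).isUnit)

theorem sol_isSolution : J.IsSolution z (J.sol z k₀ X Y) := by
  intro k
  rcases le_or_gt (k₀ + 1) k with hk | hk
  · obtain ⟨n, rfl⟩ : ∃ n : ℕ, k = k₀ + n + 1 := ⟨(k - k₀ - 1).toNat, by omega⟩
    have e0 : J.sol z k₀ X Y (k₀ + n + 1 - 1) = (J.pairRight z k₀ X Y n).1 := by
      rw [add_sub_cancel_right, sol_right]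
    have e1 : J.sol z k₀ X Y (k₀ + n + 1) = (J.pairRight z k₀ X Y n).2 := by
      have h := J.sol_right z k₀ X Y (n + 1)
      rw [show k₀ + ((n + 1 : ℕ) : ℤ) = k₀ + n + 1 by push_cast; ring] at h
      rw [h]; rfl
    have e2 : J.sol z k₀ X Y (k₀ + n + 1 + 1) = (J.pairRight z k₀ X Y (n + 1)).2 := by
      have h := J.sol_right z k₀ X Y (n + 2)
      rw [show k₀ + ((n + 2 : ℕ) : ℤ) = k₀ + n + 1 + 1 by push_cast; ring] at h
      rw [h]; rfl
    rw [e0, e1, e2, pairRight, stepRight]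
    simp only [A_mul_inv, add_sub_cancel_right]
    noncomm_ring
  · obtain ⟨n, rfl⟩ : ∃ n : ℕ, k = k₀ - n := ⟨(k₀ - k).toNat, by omega⟩
    have e0 : J.sol z k₀ X Y (k₀ - n - 1) = (J.pairLeft z k₀ X Y (n + 1)).1 := by
      rw [← sol_left]; congr 1; push_cast; ring
    have e1 : J.sol z k₀ X Y (k₀ - n + 1) = (J.pairLeft z k₀ X Y n).2 := by
      rcases n with _ | n
      · simpa [pairLeft] using J.sol_succ z k₀ X Y
      · have h := J.sol_left z k₀ X Y n
        rw [show k₀ - ((n + 1 : ℕ) : ℤ) + 1 = k₀ - n by push_cast; ring, h]; rfl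
    rw [e0, e1, sol_left, pairLeft, stepLeft]
    simp only [A_mul_inv]
    noncomm_ring

end sol

/-- The fundamental solution with `θ(z,k₀,k₀) = I`, `θ(z,k₀+1,k₀) = 0`. -/
noncomputable def theta (z : ℂ) (k k₀ : ℤ) : Matrix (Fin m) (Fin m) ℂ := J.sol z k₀ 1 0 k

/-- The fundamental solution with `φ(z,k₀,k₀) = 0`, `φ(z,k₀+1,k₀) = I`. -/
noncomputable def phi (z : ℂ) (k k₀ : ℤ) : Matrix (Fin m) (Fin m) ℂ := J.sol z k₀ 0 1 k

/-- The solution `θ - φ A(k₀)⁻¹ M`. -/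
noncomputable def weylSol (z : ℂ) (k₀ : ℤ) (M : Matrix (Fin m) (Fin m) ℂ) (k : ℤ) :
    Matrix (Fin m) (Fin m) ℂ :=
  J.theta z k k₀ - J.phi z k k₀ * (J.A k₀)⁻¹ * M

/-- The requirement that singles out `M₊(z,k₀)`: `θ - φ A(k₀)⁻¹ M` is square summable on
`(k₀, ∞) ∩ ℤ`. -/
def IsWeylPlus (z : ℂ) (k₀ : ℤ) (M : Matrix (Fin m) (Fin m) ℂ) : Prop :=
  Memℓp (fun k : Set.Ioi k₀ => J.weylSol z k₀ M k) 2

/-- The requirement that singles out `M₋(z,k₀)`: `θ - φ A(k₀)⁻¹ M` is square summable on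
`(-∞, k₀) ∩ ℤ`. -/
def IsWeylMinus (z : ℂ) (k₀ : ℤ) (M : Matrix (Fin m) (Fin m) ℂ) : Prop :=
  Memℓp (fun k : Set.Iio k₀ => J.weylSol z k₀ M k) 2

open Classical in
/-- The half-line Weyl-Titchmarsh matrix `M₊(z,k₀)`: the unique matrix satisfying `IsWeylPlus`.
The default value is never used for `z ∉ ℝ`, by the limit point property. -/
noncomputable def MPlus (z : ℂ) (k₀ : ℤ) : Matrix (Fin m) (Fin m) ℂ :=
  if h : ∃! M, J.IsWeylPlus z k₀ M then h.choose else 0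

open Classical in
/-- The half-line Weyl-Titchmarsh matrix `M₋(z,k₀)`: the unique matrix satisfying `IsWeylMinus`.
The default value is never used for `z ∉ ℝ`, by the limit point property. -/
noncomputable def MMinus (z : ℂ) (k₀ : ℤ) : Matrix (Fin m) (Fin m) ℂ :=
  if h : ∃! M, J.IsWeylMinus z k₀ M then h.choose else 0

/-- The `2m × 2m` Weyl-Titchmarsh matrix `M(z,k₀)`, in `m × m` blocks. For `z ∉ ℝ` the matrix
`M₋ - M₊` is invertible, and the lower right block is also `M₋ (M₋ - M₊)⁻¹ M₊`. -/
noncomputable def weylM (z : ℂ) (k₀ : ℤ) : Matrix (Fin m ⊕ Fin m) (Fin m ⊕ Fin m) ℂ :=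
  Matrix.fromBlocks
    (J.MMinus z k₀ - J.MPlus z k₀)⁻¹
    ((2 : ℂ)⁻¹ • ((J.MMinus z k₀ - J.MPlus z k₀)⁻¹ * (J.MMinus z k₀ + J.MPlus z k₀)))
    ((2 : ℂ)⁻¹ • ((J.MMinus z k₀ + J.MPlus z k₀) * (J.MMinus z k₀ - J.MPlus z k₀)⁻¹))
    (J.MPlus z k₀ * (J.MMinus z k₀ - J.MPlus z k₀)⁻¹ * J.MMinus z k₀)

end JacobiCoeffs

/-! Large `z` suffices, and the inverse problem becomes peeling a matrix continued fraction. For a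
solution normalized to `1` at `k₀` and decaying to the right, `X n` defined by `A(k₀+n) ψ(k₀+n+1) =
-X n ψ(k₀+n)` satisfies the Riccati recursion `X n = -a n (z - b n + X (n+1))⁻¹ a n`, and `X 0` is
`M₊`. The left half-line is the same after reflection, with `M₋ = B(k₀) - z - Y 0`.

For large `‖z‖` the recursion is a contraction on bounded sequences, so the fraction exists
(`exists_isContFrac`) and gives a geometrically decaying solution. Bounded solutions vanishing at
`k₀` are zero (`eq_zero_of_bounded_recurrence`), so this fraction really computes `M₊` or `M₋`.

As `‖z‖ → ∞`, `z X n → -(a n)²` determines `a n` by positivity. Cancelling `a n` and inverting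
leaves `X (n+1) - b n`, whose limit is `-b n`; then `X (n+1)` is known and the argument repeats
(`contFrac_coeffs_unique`). The upper blocks of `M` give the difference and sum of `M₋` and `M₊`,
hence both. -/

open Filter Topology

/-! ### Half-line continued fractions at large spectral parameter. -/

section HalfLine

variable {m : ℕ}

theorem Matrix.norm_one_le_one : ‖(1 : Matrix (Fin m) (Fin m) ℂ)‖ ≤ 1 := by
  rcases isEmpty_or_nonempty (Fin m) with h | h
  · rw [Subsingleton.elim (1 : Matrix (Fin m) (Fin m) ℂ) 0, norm_zero]
    exact zero_le_one
  · exact CStarRing.norm_one.le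

theorem Matrix.isUnit_smul_one_add {z : ℂ} {Y : Matrix (Fin m) (Fin m) ℂ} (h : ‖Y‖ < ‖z‖) :
    IsUnit (z • (1 : Matrix (Fin m) (Fin m) ℂ) + Y) := by
  have hz : z ≠ 0 := norm_pos_iff.1 ((norm_nonneg _).trans_lt h)
  have h1 : ‖-(z⁻¹ • Y)‖ < 1 := by
    rw [norm_neg, norm_smul, norm_inv, inv_mul_lt_one₀ (norm_pos_iff.2 hz)]
    exact h
  have h2 : z • (1 : Matrix (Fin m) (Fin m) ℂ) + Y = Units.mk0 z hz • (1 - -(z⁻¹ • Y)) := by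
    rw [Units.smul_mk0, sub_neg_eq_add, smul_add, smul_inv_smul₀ hz]
  rw [h2]
  exact (isUnit_one_sub_of_norm_lt_one h1).smul _

theorem Matrix.smul_one_add_mul_inv {z : ℂ} {Y : Matrix (Fin m) (Fin m) ℂ} (h : ‖Y‖ < ‖z‖) :
    (z • (1 : Matrix (Fin m) (Fin m) ℂ) + Y) * (z • (1 : Matrix (Fin m) (Fin m) ℂ) + Y)⁻¹ = 1 :=
  Matrix.mul_nonsing_inv _ ((Matrix.isUnit_iff_isUnit_det _).1 (isUnit_smul_one_add h))

/-- This form serves twice: taking norms bounds the inverse, and letting `‖z‖ → ∞` shows that `z`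
times the inverse tends to `1`. -/
theorem Matrix.smul_inv_smul_one_add {z : ℂ} {Y : Matrix (Fin m) (Fin m) ℂ} (h : ‖Y‖ < ‖z‖) :
    z • (z • (1 : Matrix (Fin m) (Fin m) ℂ) + Y)⁻¹
      = 1 - Y * (z • (1 : Matrix (Fin m) (Fin m) ℂ) + Y)⁻¹ := by
  have h1 := smul_one_add_mul_inv h
  rw [add_mul, smul_mul_assoc, one_mul] at h1
  exact eq_sub_of_add_eq h1

theorem Matrix.norm_inv_smul_one_add_le {z : ℂ} {Y : Matrix (Fin m) (Fin m) ℂ} {r : ℝ}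
    (hY : ‖Y‖ ≤ r) (hz : r < ‖z‖) :
    ‖(z • (1 : Matrix (Fin m) (Fin m) ℂ) + Y)⁻¹‖ ≤ (‖z‖ - r)⁻¹ := by
  have h := congrArg norm (smul_inv_smul_one_add (hY.trans_lt hz))
  rw [norm_smul] at h
  have h1 := norm_sub_le (1 : Matrix (Fin m) (Fin m) ℂ)
    (Y * (z • (1 : Matrix (Fin m) (Fin m) ℂ) + Y)⁻¹)
  have h2 := norm_mul_le Y (z • (1 : Matrix (Fin m) (Fin m) ℂ) + Y)⁻¹
  have h3 := mul_le_mul_of_nonneg_right hY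
    (norm_nonneg (z • (1 : Matrix (Fin m) (Fin m) ℂ) + Y)⁻¹)
  have h4 := norm_one_le_one (m := m)
  -- With `V` the inverse, `‖z‖‖V‖ ≤ 1 + r‖V‖` is solved for `‖V‖`.
  rw [← one_div (‖z‖ - r), le_div_iff₀ (sub_pos.2 hz)]
  linarith

/-- Beyond this radius the continued fraction of coefficients bounded by `C` converges. -/
def contFracRadius (C : ℝ) : ℝ := C ^ 2 + 3 * C + 2

/-- `X` is a bounded solution of the matrix continued fraction
`X n = -a n (z - b n + X (n + 1))⁻¹ a n`. -/
def IsContFrac (a b : ℕ → Matrix (Fin m) (Fin m) ℂ) (z : ℂ)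
    (X : ℕ → Matrix (Fin m) (Fin m) ℂ) : Prop :=
  ∀ n, ‖X n‖ ≤ 1 ∧
    X n = -(a n * (z • (1 : Matrix (Fin m) (Fin m) ℂ) + (X (n + 1) - b n))⁻¹ * a n)

section Estimates

variable {C : ℝ} {z : ℂ}

theorem norm_sub_le_one_add {X b : Matrix (Fin m) (Fin m) ℂ} (hX : ‖X‖ ≤ 1) (hb : ‖b‖ ≤ C) :
    ‖X - b‖ ≤ 1 + C :=
  (norm_sub_le _ _).trans (add_le_add hX hb)

theorem one_add_lt_of_contFracRadius_le (hC : 0 < C) (hz : contFracRadius C ≤ ‖z‖) :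
    1 + C < ‖z‖ := by
  unfold contFracRadius at hz
  nlinarith

/-- `contFracRadius C` equals `(1 + C) + (1 + C)²`: the first summand absorbs `‖X - b‖`, leaving the
second as lower bound for the denominator. This makes the step preserve the unit ball and contract
there. -/
theorem norm_contFrac_inv_le {X b : Matrix (Fin m) (Fin m) ℂ} (hC : 0 < C)
    (hz : contFracRadius C ≤ ‖z‖) (hX : ‖X‖ ≤ 1) (hb : ‖b‖ ≤ C) :
    ‖(z • (1 : Matrix (Fin m) (Fin m) ℂ) + (X - b))⁻¹‖ ≤ (C ^ 2 + 2 * C + 1)⁻¹ := by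
  refine (Matrix.norm_inv_smul_one_add_le (norm_sub_le_one_add hX hb)
    (one_add_lt_of_contFracRadius_le hC hz)).trans ?_
  unfold contFracRadius at hz
  exact inv_anti₀ (by positivity) (by linarith)

theorem norm_contFrac_step_le {a b X : Matrix (Fin m) (Fin m) ℂ} (hC : 0 < C)
    (hz : contFracRadius C ≤ ‖z‖) (ha : ‖a‖ ≤ C) (hb : ‖b‖ ≤ C) (hX : ‖X‖ ≤ 1) :
    ‖-(a * (z • (1 : Matrix (Fin m) (Fin m) ℂ) + (X - b))⁻¹ * a)‖ ≤ 1 := by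
  rw [norm_neg]
  calc _ ≤ C * (C ^ 2 + 2 * C + 1)⁻¹ * C := by
        refine (norm_mul_le _ _).trans (mul_le_mul ((norm_mul_le _ _).trans ?_) ha
          (norm_nonneg _) (by positivity))
        exact mul_le_mul ha (norm_contFrac_inv_le hC hz hX hb) (norm_nonneg _) hC.le
    _ ≤ 1 := by
        rw [mul_right_comm, ← div_eq_mul_inv, div_le_one (by positivity)]
        nlinarith

/-- The resolvent identity `P⁻¹ - Q⁻¹ = -P⁻¹(X - Y)Q⁻¹` puts `X - Y` between factors of norm at most
`1/2` and `1`. -/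
theorem dist_contFrac_step_le {a b X Y : Matrix (Fin m) (Fin m) ℂ} (hC : 0 < C)
    (hz : contFracRadius C ≤ ‖z‖) (ha : ‖a‖ ≤ C) (hb : ‖b‖ ≤ C) (hX : ‖X‖ ≤ 1) (hY : ‖Y‖ ≤ 1) :
    dist (-(a * (z • (1 : Matrix (Fin m) (Fin m) ℂ) + (X - b))⁻¹ * a))
      (-(a * (z • (1 : Matrix (Fin m) (Fin m) ℂ) + (Y - b))⁻¹ * a)) ≤ 1 / 2 * dist X Y := by
  have hlt := one_add_lt_of_contFracRadius_le hC hz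
  have hUX := (Matrix.isUnit_iff_isUnit_det _).1
    (Matrix.isUnit_smul_one_add ((norm_sub_le_one_add hX hb).trans_lt hlt))
  have hUY := (Matrix.isUnit_iff_isUnit_det _).1
    (Matrix.isUnit_smul_one_add ((norm_sub_le_one_add hY hb).trans_lt hlt))
  have hVX := norm_contFrac_inv_le hC hz hX hb
  have hVY := norm_contFrac_inv_le hC hz hY hb
  set P := z • (1 : Matrix (Fin m) (Fin m) ℂ) + (X - b) with hP
  set Q := z • (1 : Matrix (Fin m) (Fin m) ℂ) + (Y - b) with hQ
  have key : -(a * P⁻¹ * a) - -(a * Q⁻¹ * a) = a * P⁻¹ * (X - Y) * (Q⁻¹ * a) := by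
    have h1 : P⁻¹ - Q⁻¹ = -(P⁻¹ * (X - Y) * Q⁻¹) := by
      have h2 : X - Y = P - Q := by rw [hP, hQ]; abel
      rw [h2, mul_sub, sub_mul, Matrix.nonsing_inv_mul _ hUX, one_mul, mul_assoc,
        Matrix.mul_nonsing_inv _ hUY, mul_one, neg_sub]
    calc -(a * P⁻¹ * a) - -(a * Q⁻¹ * a) = -(a * (P⁻¹ - Q⁻¹) * a) := by noncomm_ring
      _ = _ := by rw [h1]; noncomm_ring
  rw [dist_eq_norm, dist_eq_norm, key]
  have hL : (0 : ℝ) < C ^ 2 + 2 * C + 1 := by positivity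
  have hhalf : C * (C ^ 2 + 2 * C + 1)⁻¹ ≤ 1 / 2 := by
    rw [← div_eq_mul_inv, div_le_iff₀ hL]; nlinarith
  have h1 : ‖a * P⁻¹‖ ≤ 1 / 2 :=
    ((norm_mul_le _ _).trans (mul_le_mul ha hVX (norm_nonneg _) hC.le)).trans hhalf
  have h2 : ‖Q⁻¹ * a‖ ≤ 1 :=
    ((norm_mul_le _ _).trans (mul_le_mul hVY ha (norm_nonneg _) (by positivity))).trans
      (by rw [mul_comm]; linarith)
  calc _ ≤ ‖a * P⁻¹‖ * ‖X - Y‖ * ‖Q⁻¹ * a‖ :=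
        (norm_mul_le _ _).trans (mul_le_mul_of_nonneg_right (norm_mul_le _ _) (norm_nonneg _))
    _ ≤ 1 / 2 * ‖X - Y‖ * 1 := by gcongr
    _ = _ := mul_one _

end Estimates

variable {a b : ℕ → Matrix (Fin m) (Fin m) ℂ} {C : ℝ} {z : ℂ}

open Metric in
/-- One step of the continued fraction, as a self-map of the sequences in the unit ball. -/
noncomputable def contFracMap (hC : 0 < C) (ha : ∀ n, ‖a n‖ ≤ C) (hb : ∀ n, ‖b n‖ ≤ C)
    (hz : contFracRadius C ≤ ‖z‖)
    (X : BoundedContinuousFunction ℕ (closedBall (0 : Matrix (Fin m) (Fin m) ℂ) 1)) :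
    BoundedContinuousFunction ℕ (closedBall (0 : Matrix (Fin m) (Fin m) ℂ) 1) :=
  BoundedContinuousFunction.mkOfDiscrete
    (fun n => ⟨-(a n * (z • (1 : Matrix (Fin m) (Fin m) ℂ) + ((X (n + 1)).1 - b n))⁻¹ * a n),
      mem_closedBall_zero_iff.2 (norm_contFrac_step_le hC hz (ha n) (hb n)
        (mem_closedBall_zero_iff.1 (X (n + 1)).2))⟩) 2
    (fun x y => by
      rw [Subtype.dist_eq]
      refine (dist_le_norm_add_norm _ _).trans ?_
      rw [← one_add_one_eq_two]
      exact add_le_add (norm_contFrac_step_le hC hz (ha _) (hb _)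
        (mem_closedBall_zero_iff.1 (X (x + 1)).2)) (norm_contFrac_step_le hC hz (ha _) (hb _)
        (mem_closedBall_zero_iff.1 (X (y + 1)).2)))

-- Banach's fixed point theorem is applied to all tails `X n` at once, in the sup metric, so no
-- truncation of the fraction is needed.
open Metric in
theorem exists_isContFrac (hC : 0 < C) (ha : ∀ n, ‖a n‖ ≤ C) (hb : ∀ n, ‖b n‖ ≤ C)
    (hz : contFracRadius C ≤ ‖z‖) : ∃ X, IsContFrac a b z X := by
  have : CompleteSpace (closedBall (0 : Matrix (Fin m) (Fin m) ℂ) 1) :=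
    isClosed_closedBall.completeSpace_coe
  have : Nonempty (closedBall (0 : Matrix (Fin m) (Fin m) ℂ) 1) :=
    ⟨⟨0, mem_closedBall_self zero_le_one⟩⟩
  have hF : ContractingWith (1 / 2) (contFracMap (z := z) hC ha hb hz) := by
    refine ⟨by rw [← NNReal.coe_lt_coe]; norm_num, LipschitzWith.of_dist_le_mul fun X Y => ?_⟩
    have hs : ((1 / 2 : NNReal) : ℝ) = 1 / 2 := by norm_num
    rw [hs, BoundedContinuousFunction.dist_le (by positivity)]
    intro n
    refine (dist_contFrac_step_le hC hz (ha n) (hb n) (mem_closedBall_zero_iff.1 (X (n + 1)).2)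
      (mem_closedBall_zero_iff.1 (Y (n + 1)).2)).trans ?_
    exact mul_le_mul_of_nonneg_left
      (BoundedContinuousFunction.dist_coe_le_dist (f := X) (g := Y) (n + 1)) (by norm_num)
  obtain ⟨X, hX, -⟩ := hF.exists_fixedPoint
    (BoundedContinuousFunction.const ℕ ⟨0, mem_closedBall_self zero_le_one⟩) (edist_ne_top _ _)
  refine ⟨fun n => (X n).1, fun n => ⟨mem_closedBall_zero_iff.1 (X n).2, ?_⟩⟩
  have h := congrArg (fun f : BoundedContinuousFunction ℕ
    (closedBall (0 : Matrix (Fin m) (Fin m) ℂ) 1) => (f n).1) hX.symm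
  exact h

/-- The solution attached to the continued fraction `X`, normalized by `ψ 0 = 1`. -/
noncomputable def contFracSol (a b : ℕ → Matrix (Fin m) (Fin m) ℂ) (z : ℂ)
    (X : ℕ → Matrix (Fin m) (Fin m) ℂ) : ℕ → Matrix (Fin m) (Fin m) ℂ
  | 0 => 1
  | n + 1 => (z • (1 : Matrix (Fin m) (Fin m) ℂ) + (X (n + 1) - b n))⁻¹ * a n *
      contFracSol a b z X n

theorem IsContFrac.mul_sol_succ {X : ℕ → Matrix (Fin m) (Fin m) ℂ} (hX : IsContFrac a b z X)
    (n : ℕ) : a n * contFracSol a b z X (n + 1) = -(X n * contFracSol a b z X n) := by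
  rw [(hX n).2, contFracSol]
  noncomm_ring

/-- Clearing the inverse in the definition gives `(z + X (n+1) - b n) ψ (n+1) = a n ψ n`, and `X
(n+1) ψ (n+1)` is `-a (n+1) ψ (n+2)`. -/
theorem IsContFrac.sol_recurrence {X : ℕ → Matrix (Fin m) (Fin m) ℂ} (hC : 0 < C)
    (hb : ∀ n, ‖b n‖ ≤ C) (hz : contFracRadius C ≤ ‖z‖) (hX : IsContFrac a b z X) (n : ℕ) :
    a (n + 1) * contFracSol a b z X (n + 2) + a n * contFracSol a b z X n
      + (b n - z • (1 : Matrix (Fin m) (Fin m) ℂ)) * contFracSol a b z X (n + 1) = 0 := by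
  have h1 := hX.mul_sol_succ (n + 1)
  have h2 : (z • (1 : Matrix (Fin m) (Fin m) ℂ) + (X (n + 1) - b n)) *
      contFracSol a b z X (n + 1) = a n * contFracSol a b z X n := by
    rw [contFracSol, mul_assoc, ← mul_assoc, Matrix.smul_one_add_mul_inv
      ((norm_sub_le_one_add (hX (n + 1)).1 (hb n)).trans_lt
        (one_add_lt_of_contFracRadius_le hC hz)), one_mul]
  rw [h1, ← h2]
  noncomm_ring

theorem IsContFrac.norm_sol_le {X : ℕ → Matrix (Fin m) (Fin m) ℂ} (hC : 0 < C)
    (ha : ∀ n, ‖a n‖ ≤ C) (hb : ∀ n, ‖b n‖ ≤ C) (hz : contFracRadius C ≤ ‖z‖)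
    (hX : IsContFrac a b z X) (n : ℕ) : ‖contFracSol a b z X n‖ ≤ (1 / 2) ^ n := by
  induction n with
  | zero => simpa [contFracSol] using Matrix.norm_one_le_one (m := m)
  | succ n ih =>
    rw [contFracSol, pow_succ']
    refine (norm_mul_le _ _).trans (mul_le_mul ?_ ih (norm_nonneg _) (by norm_num))
    refine ((norm_mul_le _ _).trans (mul_le_mul
      (norm_contFrac_inv_le hC hz (hX (n + 1)).1 (hb n)) (ha n) (norm_nonneg _)
        (by positivity))).trans ?_
    rw [mul_comm, ← div_eq_mul_inv, div_le_iff₀ (by positivity)]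
    nlinarith

theorem IsContFrac.exists_decaying_solution {X : ℕ → Matrix (Fin m) (Fin m) ℂ} (hC : 0 < C)
    (ha : ∀ n, ‖a n‖ ≤ C) (hb : ∀ n, ‖b n‖ ≤ C) (hz : contFracRadius C ≤ ‖z‖)
    (hX : IsContFrac a b z X) :
    ∃ ψ : ℕ → Matrix (Fin m) (Fin m) ℂ, ψ 0 = 1 ∧ a 0 * ψ 1 = -X 0 ∧
      (∀ n, a (n + 1) * ψ (n + 2) + a n * ψ n
        + (b n - z • (1 : Matrix (Fin m) (Fin m) ℂ)) * ψ (n + 1) = 0) ∧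
      ∀ n, ‖ψ n‖ ≤ (1 / 2) ^ n :=
  ⟨contFracSol a b z X, rfl, by rw [hX.mul_sol_succ, contFracSol, mul_one],
    hX.sol_recurrence hC hb hz, hX.norm_sol_le hC ha hb hz⟩

/-- A maximum principle: if `S` is the supremum of the norms, the recurrence gives `‖z‖ S ≤ 3 C S`,
while `3 C < ‖z‖`. -/
theorem eq_zero_of_bounded_recurrence {u : ℕ → Matrix (Fin m) (Fin m) ℂ} (hC : 0 < C)
    (ha : ∀ n, ‖a n‖ ≤ C) (hb : ∀ n, ‖b n‖ ≤ C) (hz : contFracRadius C ≤ ‖z‖)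
    (hu : ∀ n, a (n + 1) * u (n + 2) + a n * u n
      + (b n - z • (1 : Matrix (Fin m) (Fin m) ℂ)) * u (n + 1) = 0)
    (h0 : u 0 = 0) (hbdd : BddAbove (Set.range fun n => ‖u n‖)) (n : ℕ) : u n = 0 := by
  set S := ⨆ n, ‖u n‖ with hS
  have hle : ∀ n, ‖u n‖ ≤ S := fun n => le_ciSup hbdd n
  have hS0 : 0 ≤ S := (norm_nonneg _).trans (hle 0)
  have hz0 : 3 * C < ‖z‖ := by unfold contFracRadius at hz; nlinarith
  have hstep : ∀ n, ‖z‖ * ‖u n‖ ≤ 3 * C * S := by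
    intro n
    rcases n with _ | n
    · rw [h0, norm_zero, mul_zero]; positivity
    have h1 : z • u (n + 1) = a (n + 1) * u (n + 2) + a n * u n + b n * u (n + 1) := by
      have h2 := hu n
      rw [sub_mul, smul_mul_assoc, one_mul, ← add_sub_assoc, sub_eq_zero] at h2
      exact h2.symm
    rw [← norm_smul, h1]
    have hm : ∀ {P Q : Matrix (Fin m) (Fin m) ℂ}, ‖P‖ ≤ C → ‖Q‖ ≤ S → ‖P * Q‖ ≤ C * S :=
      fun hP hQ => (norm_mul_le _ _).trans (mul_le_mul hP hQ (norm_nonneg _) hC.le)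
    refine (norm_add₃_le).trans ?_
    linarith [hm (ha (n + 1)) (hle (n + 2)), hm (ha n) (hle n), hm (hb n) (hle (n + 1))]
  have hzS : ‖z‖ * S ≤ 3 * C * S := by
    have hzp : 0 < ‖z‖ := by linarith
    rw [← le_div_iff₀' hzp]
    exact ciSup_le fun n => (le_div_iff₀' hzp).2 (hstep n)
  have hSz : S ≤ 0 := by
    by_contra! hpos
    exact absurd hzS (mul_lt_mul_of_pos_right hz0 hpos).not_ge
  exact norm_le_zero_iff.1 ((hle n).trans hSz)

end HalfLine

/-! ### Asymptotics and recovery of the coefficients. -/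

section Limits

variable {m : ℕ} {a b : ℕ → Matrix (Fin m) (Fin m) ℂ} {C : ℝ} {l : Filter ℂ}
  {X : ℂ → ℕ → Matrix (Fin m) (Fin m) ℂ}

theorem tendsto_contFrac_inv (hl : Tendsto norm l atTop) (hb : ∀ n, ‖b n‖ ≤ C)
    (hX : ∀ᶠ z in l, IsContFrac a b z (X z)) (n : ℕ) :
    Tendsto (fun z : ℂ => (z • (1 : Matrix (Fin m) (Fin m) ℂ) + (X z (n + 1) - b n))⁻¹)
      l (𝓝 0) := by
  refine squeeze_zero_norm' (a := fun z : ℂ => (‖z‖ - (1 + C))⁻¹) ?_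
    (tendsto_inv_atTop_zero.comp (tendsto_atTop_add_const_right _ _ hl))
  filter_upwards [hX, hl.eventually_gt_atTop (1 + C)] with z hz hlt
  exact Matrix.norm_inv_smul_one_add_le (norm_sub_le_one_add (hz (n + 1)).1 (hb n)) hlt

theorem tendsto_contFrac (hl : Tendsto norm l atTop) (hb : ∀ n, ‖b n‖ ≤ C)
    (hX : ∀ᶠ z in l, IsContFrac a b z (X z)) (n : ℕ) :
    Tendsto (fun z => X z n) l (𝓝 0) := by
  have h := ((tendsto_contFrac_inv hl hb hX n).const_mul (a n)).mul_const (a n)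
  have h' := h.neg
  rw [mul_zero, zero_mul, neg_zero] at h'
  refine h'.congr' ?_
  filter_upwards [hX] with z hz using (hz n).2.symm

theorem tendsto_smul_contFrac (hl : Tendsto norm l atTop) (hb : ∀ n, ‖b n‖ ≤ C)
    (hX : ∀ᶠ z in l, IsContFrac a b z (X z)) (n : ℕ) :
    Tendsto (fun z => z • X z n) l (𝓝 (-(a n * a n))) := by
  have hV : Tendsto (fun z : ℂ =>
      z • (z • (1 : Matrix (Fin m) (Fin m) ℂ) + (X z (n + 1) - b n))⁻¹) l (𝓝 1) := by
    have h := (((tendsto_contFrac hl hb hX (n + 1)).sub_const (b n)).mul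
      (tendsto_contFrac_inv hl hb hX n)).const_sub 1
    rw [mul_zero, sub_zero] at h
    refine h.congr' ?_
    filter_upwards [hX, hl.eventually_gt_atTop (1 + C)] with z hz hlt
    exact (Matrix.smul_inv_smul_one_add
      ((norm_sub_le_one_add (hz (n + 1)).1 (hb n)).trans_lt hlt)).symm
  have h := ((hV.const_mul (a n)).mul_const (a n)).neg
  rw [mul_one] at h
  refine h.congr' ?_
  filter_upwards [hX] with z hz
  rw [(hz n).2, mul_smul_comm, smul_mul_assoc, smul_neg]

-- Positive square roots are unique. The asymptotics see only squares, so positivity, not just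
-- invertibility, is needed here.
open scoped MatrixOrder in
theorem Matrix.PosDef.eq_of_mul_self_eq {P Q : Matrix (Fin m) (Fin m) ℂ} (hP : P.PosDef)
    (hQ : Q.PosDef) (h : P * P = Q * Q) : P = Q := by
  rw [← CFC.sqrt_mul_self P hP.posSemidef.nonneg, h, CFC.sqrt_mul_self Q hQ.posSemidef.nonneg]

/-- The value at `0` of the continued fraction, for large `z`, determines all coefficients. -/
theorem contFrac_coeffs_unique [NeBot l] {a' b' : ℕ → Matrix (Fin m) (Fin m) ℂ} {C' : ℝ}
    {X' : ℂ → ℕ → Matrix (Fin m) (Fin m) ℂ} (hl : Tendsto norm l atTop)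
    (ha : ∀ n, (a n).PosDef) (ha' : ∀ n, (a' n).PosDef)
    (hb : ∀ n, ‖b n‖ ≤ C) (hb' : ∀ n, ‖b' n‖ ≤ C')
    (hX : ∀ᶠ z in l, IsContFrac a b z (X z)) (hX' : ∀ᶠ z in l, IsContFrac a' b' z (X' z))
    (h0 : ∀ᶠ z in l, X z 0 = X' z 0) (n : ℕ) : a n = a' n ∧ b n = b' n := by
  have haux : ∀ n, (∀ᶠ z in l, X z n = X' z n) →
      a n = a' n ∧ b n = b' n ∧ ∀ᶠ z in l, X z (n + 1) = X' z (n + 1) := by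
    intro n hn
    have haa : a n = a' n := by
      refine (ha n).eq_of_mul_self_eq (ha' n) (neg_injective ?_)
      refine tendsto_nhds_unique (tendsto_smul_contFrac hl hb hX n)
        ((tendsto_smul_contFrac hl hb' hX' n).congr' ?_)
      filter_upwards [hn] with z hz
      rw [hz]
    -- The outer factors `a n` are invertible and now common to both sides, so the inner inverses
    -- agree, and so do the denominators.
    have hdiff : ∀ᶠ z in l, X z (n + 1) - b n = X' z (n + 1) - b' n := by
      filter_upwards [hn, hX, hX', hl.eventually_gt_atTop (1 + C)] with z hz h h' hlt
      rw [(h n).2, (h' n).2, ← haa, neg_inj, (ha n).isUnit.mul_left_inj,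
        (ha n).isUnit.mul_right_inj] at hz
      exact add_left_cancel (Matrix.inv_inj hz ((Matrix.isUnit_iff_isUnit_det _).1
        (Matrix.isUnit_smul_one_add ((norm_sub_le_one_add (h (n + 1)).1 (hb n)).trans_lt hlt))))
    have hbb : b n = b' n := by
      have h1 := (tendsto_contFrac hl hb hX (n + 1)).sub_const (b n)
      have h2 := (tendsto_contFrac hl hb' hX' (n + 1)).sub_const (b' n)
      have h3 := tendsto_nhds_unique h1 (h2.congr' (hdiff.mono fun z hz => hz.symm))
      simpa using h3
    refine ⟨haa, hbb, ?_⟩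
    filter_upwards [hdiff] with z hz
    rwa [hbb, sub_left_inj] at hz
  have hall : ∀ n, ∀ᶠ z in l, X z n = X' z n := by
    intro n
    induction n with
    | zero => exact h0
    | succ n ih => exact (haux n ih).2.2
  exact ⟨(haux n (hall n)).1, (haux n (hall n)).2.1⟩

end Limits

/-! ### Second-order recurrences and square summability. -/

section Sequences

variable {m : ℕ}

theorem eq_of_recurrence {a c : ℕ → Matrix (Fin m) (Fin m) ℂ} (ha : ∀ n, IsUnit (a n))
    {u v : ℕ → Matrix (Fin m) (Fin m) ℂ}
    (hu : ∀ n, a (n + 1) * u (n + 2) + a n * u n + c n * u (n + 1) = 0)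
    (hv : ∀ n, a (n + 1) * v (n + 2) + a n * v n + c n * v (n + 1) = 0)
    (h0 : u 0 = v 0) (h1 : u 1 = v 1) (n : ℕ) : u n = v n := by
  induction n using Nat.twoStepInduction with
  | zero => exact h0
  | one => exact h1
  | more n ih ih' =>
    have h := (hu n).trans (hv n).symm
    rw [ih, ih', add_left_inj, add_left_inj] at h
    exact (ha (n + 1)).mul_right_inj.1 h

theorem memlp_two_of_norm_le_geometric {ι : Type*} {w : ι → Matrix (Fin m) (Fin m) ℂ} {i : ι → ℕ}
    (hi : Function.Injective i) (hw : ∀ k, ‖w k‖ ≤ (1 / 2) ^ i k) : Memℓp w 2 := by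
  have hs : Summable fun k => ((1 / 4 : ℝ)) ^ i k :=
    (summable_geometric_of_lt_one (by norm_num) (by norm_num)).comp_injective hi
  refine (memℓp_gen_iff (by norm_num)).2 (hs.of_nonneg_of_le (fun k => by positivity) fun k => ?_)
  have h := pow_le_pow_left₀ (norm_nonneg _) (hw k) 2
  rw [← pow_mul, mul_comm, pow_mul] at h
  norm_num at h ⊢
  exact h

end Sequences

/-! ### Weyl–Titchmarsh matrices as continued fractions. -/

namespace JacobiCoeffs

variable {m : ℕ} (J : JacobiCoeffs m) {z : ℂ} {k₀ : ℤ}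

theorem bound_pos : 0 < J.bound := J.bounded.choose_spec.1

theorem isUnit_A (k : ℤ) : IsUnit (J.A k) := (J.A_posDef k).isUnit

section IsSolution

variable {J} {ψ χ : ℤ → Matrix (Fin m) (Fin m) ℂ}

theorem IsSolution.sub (hψ : J.IsSolution z ψ) (hχ : J.IsSolution z χ) :
    J.IsSolution z (fun k => ψ k - χ k) := by
  intro k
  have h : _ = (0 : Matrix (Fin m) (Fin m) ℂ) - 0 := congrArg₂ (· - ·) (hψ k) (hχ k)
  rw [sub_zero] at h
  rw [← h]
  noncomm_ring

theorem IsSolution.mul_right (hψ : J.IsSolution z ψ) (P : Matrix (Fin m) (Fin m) ℂ) :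
    J.IsSolution z (fun k => ψ k * P) := by
  intro k
  have h := congrArg (· * P) (hψ k)
  simpa only [add_mul, mul_assoc, zero_mul] using h

theorem IsSolution.right (hψ : J.IsSolution z ψ) (n : ℕ) :
    J.A (k₀ + (n + 1 : ℕ)) * ψ (k₀ + (n + 2 : ℕ)) + J.A (k₀ + n) * ψ (k₀ + n)
      + (J.B (k₀ + (n + 1 : ℕ)) - z • (1 : Matrix (Fin m) (Fin m) ℂ)) *
        ψ (k₀ + (n + 1 : ℕ)) = 0 := by
  have h := hψ (k₀ + (n + 1 : ℕ))
  rwa [show k₀ + ((n + 1 : ℕ) : ℤ) + 1 = k₀ + (n + 2 : ℕ) by push_cast; ring,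
    show k₀ + ((n + 1 : ℕ) : ℤ) - 1 = k₀ + n by push_cast; ring] at h

/-- Sites `k₀ - n` and `k₀ - n - 1` are coupled by `A (k₀ - 1 - n)`, so reflection gives the
half-line recurrence with `a n = A (k₀ - 1 - n)` and `b n = B (k₀ - 1 - n)`. On the right `a n`
starts at `A k₀` instead. -/
theorem IsSolution.left (hψ : J.IsSolution z ψ) (n : ℕ) :
    J.A (k₀ - 1 - (n + 1 : ℕ)) * ψ (k₀ - (n + 2 : ℕ)) + J.A (k₀ - 1 - n) * ψ (k₀ - n)
      + (J.B (k₀ - 1 - n) - z • (1 : Matrix (Fin m) (Fin m) ℂ)) * ψ (k₀ - (n + 1 : ℕ)) = 0 := by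
  have h := hψ (k₀ - 1 - n)
  rw [show k₀ - 1 - (n : ℤ) + 1 = k₀ - n by ring,
    show k₀ - 1 - (n : ℤ) - 1 = k₀ - 1 - (n + 1 : ℕ) by push_cast; ring] at h
  rw [show k₀ - ((n + 1 : ℕ) : ℤ) = k₀ - 1 - n by push_cast; ring,
    show k₀ - ((n + 2 : ℕ) : ℤ) = k₀ - 1 - (n + 1 : ℕ) by push_cast; ring,
    add_comm (J.A (k₀ - 1 - (n + 1 : ℕ)) * _)]
  exact h

end IsSolution

section weylSol

variable (z k₀) (M : Matrix (Fin m) (Fin m) ℂ)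

theorem weylSol_isSolution : J.IsSolution z (J.weylSol z k₀ M) := by
  have h := (J.sol_isSolution z k₀ 1 0).sub
    (((J.sol_isSolution z k₀ 0 1).mul_right (J.A k₀)⁻¹).mul_right M)
  exact h

theorem weylSol_self : J.weylSol z k₀ M k₀ = 1 := by
  simp [weylSol, theta, phi, sol_self]

theorem A_mul_weylSol_succ : J.A k₀ * J.weylSol z k₀ M (k₀ + 1) = -M := by
  simp [weylSol, theta, phi, sol_succ, A_mul_inv]

/-- The difference equation at `k₀` transfers the data from `k₀ + 1` to `k₀ - 1`; this is the source
of the term `B(k₀) - z` in `M₋`. -/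
theorem A_mul_weylSol_pred : J.A (k₀ - 1) * J.weylSol z k₀ M (k₀ - 1)
    = M - (J.B k₀ - z • (1 : Matrix (Fin m) (Fin m) ℂ)) := by
  have h := J.weylSol_isSolution z k₀ M k₀
  rw [A_mul_weylSol_succ, weylSol_self, mul_one, ← eq_neg_iff_add_eq_zero, neg_add_eq_iff_eq_add]
    at h
  rw [h, ← sub_eq_add_neg]

end weylSol

/-- The Weyl solution with parameter `X 0` agrees with the decaying solution at `k₀` and `k₀ + 1`,
hence on the whole half-line. -/
theorem isWeylPlus_of_isContFrac {X : ℕ → Matrix (Fin m) (Fin m) ℂ}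
    (hz : contFracRadius J.bound ≤ ‖z‖)
    (hX : IsContFrac (fun n : ℕ => J.A (k₀ + n)) (fun n : ℕ => J.B (k₀ + (n + 1 : ℕ))) z X) :
    J.IsWeylPlus z k₀ (X 0) := by
  obtain ⟨ψ, h0, h1, hψ, hdecay⟩ := hX.exists_decaying_solution J.bound_pos
    (fun n => J.norm_A_le _) (fun n => J.norm_B_le _) hz
  have hu := eq_of_recurrence (a := fun n : ℕ => J.A (k₀ + n))
    (u := fun n : ℕ => J.weylSol z k₀ (X 0) (k₀ + n)) (fun n : ℕ => J.isUnit_A (k₀ + n))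
    (J.weylSol_isSolution z k₀ (X 0)).right hψ (by simp [weylSol_self, h0])
    ((J.isUnit_A k₀).mul_right_inj.1 (by
      rw [Nat.cast_zero, add_zero] at h1
      rw [Nat.cast_one, A_mul_weylSol_succ, h1]))
  refine memlp_two_of_norm_le_geometric (i := fun k => (k.1 - k₀).toNat) (fun k l h => ?_)
    fun k => ?_
  · have hk : k₀ < k.1 := k.2
    have hl : k₀ < l.1 := l.2
    exact Subtype.ext (by simp only at h; omega)
  · have hk : k₀ < k.1 := k.2
    have h := hdecay (k.1 - k₀).toNat
    rwa [← hu, show k₀ + ((k.1 - k₀).toNat : ℤ) = k.1 by omega] at h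

theorem isWeylMinus_of_isContFrac {X : ℕ → Matrix (Fin m) (Fin m) ℂ}
    (hz : contFracRadius J.bound ≤ ‖z‖)
    (hX : IsContFrac (fun n : ℕ => J.A (k₀ - 1 - n)) (fun n : ℕ => J.B (k₀ - 1 - n)) z X) :
    J.IsWeylMinus z k₀ (J.B k₀ - z • (1 : Matrix (Fin m) (Fin m) ℂ) - X 0) := by
  obtain ⟨ψ, h0, h1, hψ, hdecay⟩ := hX.exists_decaying_solution J.bound_pos
    (fun n => J.norm_A_le _) (fun n => J.norm_B_le _) hz
  have hu := eq_of_recurrence (a := fun n : ℕ => J.A (k₀ - 1 - n))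
    (u := fun n : ℕ => J.weylSol z k₀
      (J.B k₀ - z • (1 : Matrix (Fin m) (Fin m) ℂ) - X 0) (k₀ - n))
    (fun n : ℕ => J.isUnit_A (k₀ - 1 - n))
    (J.weylSol_isSolution z k₀ _).left hψ (by simp [weylSol_self, h0])
    ((J.isUnit_A (k₀ - 1)).mul_right_inj.1 (by
      rw [Nat.cast_zero, sub_zero] at h1
      rw [Nat.cast_one, A_mul_weylSol_pred, h1]
      abel))
  refine memlp_two_of_norm_le_geometric (i := fun k => (k₀ - k.1).toNat) (fun k l h => ?_)
    fun k => ?_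
  · have hk : k.1 < k₀ := k.2
    have hl : l.1 < k₀ := l.2
    exact Subtype.ext (by simp only at h; omega)
  · have hk : k.1 < k₀ := k.2
    have h := hdecay (k₀ - k.1).toNat
    rwa [← hu, show k₀ - ((k₀ - k.1).toNat : ℤ) = k.1 by omega] at h

/-- Square summability implies boundedness, so the difference of the two Weyl solutions, zero at
`k₀`, vanishes; its value at `k₀ + 1` then identifies the parameters. -/
theorem IsWeylPlus.eq {J : JacobiCoeffs m} (hz : contFracRadius J.bound ≤ ‖z‖)
    {M N : Matrix (Fin m) (Fin m) ℂ} (hM : J.IsWeylPlus z k₀ M) (hN : J.IsWeylPlus z k₀ N) :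
    M = N := by
  obtain ⟨c, hc⟩ := memℓp_infty_iff.1 ((Memℓp.sub hM hN).of_exponent_ge le_top)
  have h0 : J.weylSol z k₀ M k₀ - J.weylSol z k₀ N k₀ = 0 := by
    rw [weylSol_self, weylSol_self, sub_self]
  have h := eq_zero_of_bounded_recurrence (a := fun n : ℕ => J.A (k₀ + n))
    (b := fun n : ℕ => J.B (k₀ + (n + 1 : ℕ)))
    (u := fun n : ℕ => J.weylSol z k₀ M (k₀ + n) - J.weylSol z k₀ N (k₀ + n)) J.bound_pos
    (fun n => J.norm_A_le _) (fun n => J.norm_B_le _) hz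
    ((J.weylSol_isSolution z k₀ M).sub (J.weylSol_isSolution z k₀ N)).right
    -- The site `k₀` lies outside the open half-line where `c` is a bound, and is covered by the
    -- `0`.
    (by simpa using h0) ⟨max c 0, by
      rintro _ ⟨n, rfl⟩
      rcases n with _ | n
      · simp [h0]
      · exact le_max_of_le_left (hc ⟨⟨k₀ + (n + 1 : ℕ), Set.mem_Ioi.2 (by omega)⟩, rfl⟩)⟩ 1
  have h1 := congrArg (J.A k₀ * ·) h
  simp only [Nat.cast_one, mul_sub, A_mul_weylSol_succ, mul_zero, sub_eq_zero] at h1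
  exact neg_injective h1

theorem IsWeylMinus.eq {J : JacobiCoeffs m} (hz : contFracRadius J.bound ≤ ‖z‖)
    {M N : Matrix (Fin m) (Fin m) ℂ} (hM : J.IsWeylMinus z k₀ M) (hN : J.IsWeylMinus z k₀ N) :
    M = N := by
  obtain ⟨c, hc⟩ := memℓp_infty_iff.1 ((Memℓp.sub hM hN).of_exponent_ge le_top)
  have h0 : J.weylSol z k₀ M k₀ - J.weylSol z k₀ N k₀ = 0 := by
    rw [weylSol_self, weylSol_self, sub_self]
  have h := eq_zero_of_bounded_recurrence (a := fun n : ℕ => J.A (k₀ - 1 - n))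
    (b := fun n : ℕ => J.B (k₀ - 1 - n))
    (u := fun n : ℕ => J.weylSol z k₀ M (k₀ - n) - J.weylSol z k₀ N (k₀ - n)) J.bound_pos
    (fun n => J.norm_A_le _) (fun n => J.norm_B_le _) hz
    ((J.weylSol_isSolution z k₀ M).sub (J.weylSol_isSolution z k₀ N)).left
    (by simpa using h0) ⟨max c 0, by
      rintro _ ⟨n, rfl⟩
      rcases n with _ | n
      · simp [h0]
      · exact le_max_of_le_left (hc ⟨⟨k₀ - (n + 1 : ℕ), Set.mem_Iio.2 (by omega)⟩, rfl⟩)⟩ 1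
  have h1 := congrArg (J.A (k₀ - 1) * ·) h
  simpa only [Nat.cast_one, mul_sub, A_mul_weylSol_pred, mul_zero, sub_eq_zero, sub_left_inj]
    using h1

/-- At large `‖z‖` existence of one Weyl matrix already gives unique existence, so the default value
in `MPlus` is not taken. -/
theorem IsWeylPlus.MPlus_eq {J : JacobiCoeffs m} (hz : contFracRadius J.bound ≤ ‖z‖)
    {M : Matrix (Fin m) (Fin m) ℂ} (hM : J.IsWeylPlus z k₀ M) : J.MPlus z k₀ = M := by
  have h : ∃! M, J.IsWeylPlus z k₀ M := ⟨M, hM, fun N hN => IsWeylPlus.eq hz hN hM⟩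
  rw [MPlus, dif_pos h]
  exact IsWeylPlus.eq hz h.choose_spec.1 hM

theorem IsWeylMinus.MMinus_eq {J : JacobiCoeffs m} (hz : contFracRadius J.bound ≤ ‖z‖)
    {M : Matrix (Fin m) (Fin m) ℂ} (hM : J.IsWeylMinus z k₀ M) : J.MMinus z k₀ = M := by
  have h : ∃! M, J.IsWeylMinus z k₀ M := ⟨M, hM, fun N hN => IsWeylMinus.eq hz hN hM⟩
  rw [MMinus, dif_pos h]
  exact IsWeylMinus.eq hz h.choose_spec.1 hM

/-- `M₊(z,k₀)` as a matrix continued fraction in the coefficients to the right of `k₀`. -/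
theorem exists_isContFrac_MPlus (k₀ : ℤ) (hz : contFracRadius J.bound ≤ ‖z‖) :
    ∃ X, IsContFrac (fun n : ℕ => J.A (k₀ + n)) (fun n : ℕ => J.B (k₀ + (n + 1 : ℕ))) z X ∧
      J.MPlus z k₀ = X 0 := by
  obtain ⟨X, hX⟩ := exists_isContFrac (a := fun n : ℕ => J.A (k₀ + n))
    (b := fun n : ℕ => J.B (k₀ + (n + 1 : ℕ))) J.bound_pos
    (fun n => J.norm_A_le _) (fun n => J.norm_B_le _) hz
  exact ⟨X, hX, (J.isWeylPlus_of_isContFrac hz hX).MPlus_eq hz⟩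

/-- `M₋(z,k₀)` as a matrix continued fraction in the coefficients to the left of `k₀`. -/
theorem exists_isContFrac_MMinus (k₀ : ℤ) (hz : contFracRadius J.bound ≤ ‖z‖) :
    ∃ X, IsContFrac (fun n : ℕ => J.A (k₀ - 1 - n)) (fun n : ℕ => J.B (k₀ - 1 - n)) z X ∧
      J.MMinus z k₀ = J.B k₀ - z • (1 : Matrix (Fin m) (Fin m) ℂ) - X 0 := by
  obtain ⟨X, hX⟩ := exists_isContFrac (a := fun n : ℕ => J.A (k₀ - 1 - n))
    (b := fun n : ℕ => J.B (k₀ - 1 - n)) J.bound_pos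
    (fun n => J.norm_A_le _) (fun n => J.norm_B_le _) hz
  exact ⟨X, hX, (J.isWeylMinus_of_isContFrac hz hX).MMinus_eq hz⟩

/-- The difference is `-(z + X 0 + Y 0 - B(k₀))`, a bounded perturbation of `-z`. This ensures that
the inverse in `weylM` is a genuine one. -/
theorem isUnit_MMinus_sub_MPlus (k₀ : ℤ) (hz : contFracRadius J.bound ≤ ‖z‖) :
    IsUnit (J.MMinus z k₀ - J.MPlus z k₀) := by
  obtain ⟨X, hX, hMX⟩ := J.exists_isContFrac_MPlus k₀ hz
  obtain ⟨Y, hY, hMY⟩ := J.exists_isContFrac_MMinus k₀ hz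
  have h : J.MMinus z k₀ - J.MPlus z k₀
      = -(z • (1 : Matrix (Fin m) (Fin m) ℂ) + (X 0 + Y 0 - J.B k₀)) := by
    rw [hMX, hMY]; abel
  rw [h, IsUnit.neg_iff]
  refine Matrix.isUnit_smul_one_add ?_
  have hlt : 2 + J.bound < ‖z‖ := by
    unfold contFracRadius at hz
    nlinarith [J.bound_pos]
  linarith [norm_sub_le (X 0 + Y 0) (J.B k₀), norm_add_le (X 0) (Y 0), (hX 0).1, (hY 0).1,
    J.norm_B_le k₀]

/-- The upper left block gives `M₋ - M₊`; cancelling it from the upper right block gives `M₋ + M₊`.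
Largeness of `z` for `J` alone is enough, since equality with a genuine inverse forces the two
differences to agree. -/
theorem MMinus_MPlus_eq_of_weylM_eq {J J' : JacobiCoeffs m} (hz : contFracRadius J.bound ≤ ‖z‖)
    (h : J.weylM z k₀ = J'.weylM z k₀) :
    J.MMinus z k₀ = J'.MMinus z k₀ ∧ J.MPlus z k₀ = J'.MPlus z k₀ := by
  obtain ⟨h11, h12, -, -⟩ := Matrix.fromBlocks_inj.1 h
  have hD := J.isUnit_MMinus_sub_MPlus k₀ hz
  have hdet := (Matrix.isUnit_iff_isUnit_det _).1 hD
  have hsub := Matrix.inv_inj h11 hdet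
  rw [← h11] at h12
  have hadd := ((Matrix.isUnit_nonsing_inv_iff).2 hD).mul_right_inj.1
    (smul_right_injective _ (inv_ne_zero (two_ne_zero' ℂ)) h12)
  constructor
  · refine smul_right_injective _ (two_ne_zero' ℂ) ?_
    have h1 := congrArg₂ (· + ·) hsub hadd
    simp only [two_smul]
    simpa [sub_add_add_cancel] using h1
  · refine smul_right_injective _ (two_ne_zero' ℂ) ?_
    have h1 := congrArg₂ (· - ·) hadd hsub
    simp only [two_smul]
    simpa [add_sub_sub_cancel] using h1

/-- All other fields are proofs, so even the chosen `bound` agrees, and with it `H`. -/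
theorem ext_coeffs {J J' : JacobiCoeffs m} (hA : ∀ k, J.A k = J'.A k)
    (hB : ∀ k, J.B k = J'.B k) : J = J' := by
  cases J
  cases J'
  obtain rfl := funext hA
  obtain rfl := funext hB
  rfl

/-- The half-line matrices `M₋` and `M₊`, for large `z`, determine all coefficients. -/
theorem eq_of_MMinus_MPlus_eventuallyEq {J J' : JacobiCoeffs m} {l : Filter ℂ} [NeBot l]
    (hl : Tendsto norm l atTop) (hminus : ∀ᶠ z in l, J.MMinus z k₀ = J'.MMinus z k₀)
    (hplus : ∀ᶠ z in l, J.MPlus z k₀ = J'.MPlus z k₀) : J = J' := by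
  have hJ := hl.eventually_ge_atTop (contFracRadius J.bound)
  have hJ' := hl.eventually_ge_atTop (contFracRadius J'.bound)
  -- The fractions are chosen separately for each `z`; no regularity in `z` is needed, because the
  -- limits rest on the uniform bound `‖X n‖ ≤ 1`.
  choose! X hX hMX using fun z (hz : contFracRadius J.bound ≤ ‖z‖) =>
    J.exists_isContFrac_MPlus k₀ hz
  choose! X' hX' hMX' using fun z (hz : contFracRadius J'.bound ≤ ‖z‖) =>
    J'.exists_isContFrac_MPlus k₀ hz
  choose! Y hY hMY using fun z (hz : contFracRadius J.bound ≤ ‖z‖) =>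
    J.exists_isContFrac_MMinus k₀ hz
  choose! Y' hY' hMY' using fun z (hz : contFracRadius J'.bound ≤ ‖z‖) =>
    J'.exists_isContFrac_MMinus k₀ hz
  have hright := contFrac_coeffs_unique hl (fun n => J.A_posDef _) (fun n => J'.A_posDef _)
    (fun n => J.norm_B_le _) (fun n => J'.norm_B_le _) (hJ.mono hX) (hJ'.mono hX')
    (by filter_upwards [hJ, hJ', hplus] with z h h' hp using by rw [← hMX z h, ← hMX' z h', hp])
  have hdiff : ∀ᶠ z in l, J.B k₀ - Y z 0 = J'.B k₀ - Y' z 0 := by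
    filter_upwards [hJ, hJ', hminus] with z h h' hm
    rw [hMY z h, hMY' z h', sub_right_comm, sub_right_comm (J'.B k₀), sub_left_inj] at hm
    exact hm
  -- `B k₀` belongs to neither half-line fraction; it is the limit of `M₋ + z`, as `Y z 0 → 0`.
  have hB0 : J.B k₀ = J'.B k₀ := by
    have h1 := (tendsto_contFrac hl (fun n => J.norm_B_le _) (hJ.mono hY) 0).const_sub (J.B k₀)
    have h2 := (tendsto_contFrac hl (fun n => J'.norm_B_le _) (hJ'.mono hY') 0).const_sub
      (J'.B k₀)
    simpa using tendsto_nhds_unique h1 (h2.congr' (hdiff.mono fun z hz => hz.symm))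
  have hleft := contFrac_coeffs_unique hl (fun n => J.A_posDef _) (fun n => J'.A_posDef _)
    (fun n => J.norm_B_le _) (fun n => J'.norm_B_le _) (hJ.mono hY) (hJ'.mono hY')
    (by filter_upwards [hdiff] with z hz using by rwa [hB0, sub_right_inj] at hz)
  refine ext_coeffs (fun k => ?_) fun k => ?_
  · rcases le_or_gt k₀ k with hk | hk
    · have h := (hright (k - k₀).toNat).1
      rwa [show k₀ + ((k - k₀).toNat : ℤ) = k by omega] at h
    · have h := (hleft (k₀ - 1 - k).toNat).1
      rwa [show k₀ - 1 - ((k₀ - 1 - k).toNat : ℤ) = k by omega] at h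
  · rcases lt_trichotomy k k₀ with hk | rfl | hk
    · have h := (hleft (k₀ - 1 - k).toNat).2
      rwa [show k₀ - 1 - ((k₀ - 1 - k).toNat : ℤ) = k by omega] at h
    · exact hB0
    · have h := (hright (k - k₀ - 1).toNat).2
      rwa [show k₀ + (((k - k₀ - 1).toNat + 1 : ℕ) : ℤ) = k by omega] at h

end JacobiCoeffs

/-! ### The uniqueness theorem. -/

theorem theorem4p2 (m : ℕ) (k₀ : ℤ) (J₁ J₂ : JacobiCoeffs m)
    (hM : ∀ z : ℂ, 0 < z.im → J₁.weylM z k₀ = J₂.weylM z k₀) :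
    J₁.H = J₂.H ∧ (∀ k : ℤ, J₁.A k = J₂.A k) ∧ (∀ k : ℤ, J₁.B k = J₂.B k) := by
  -- The positive imaginary axis lies in the upper half-plane and reaches infinity, which is all the
  -- argument uses.
  let l : Filter ℂ := map (fun y : ℝ => (y : ℂ) * Complex.I) atTop
  have hl : Tendsto norm l atTop := by
    refine tendsto_map'_iff.2 (tendsto_abs_atTop_atTop.congr fun y => ?_)
    simp
  have him : ∀ᶠ z in l, 0 < z.im := by
    refine eventually_map.2 ?_
    filter_upwards [eventually_gt_atTop (0 : ℝ)] with y hy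
    simpa using hy
  have h : ∀ᶠ z in l, J₁.MMinus z k₀ = J₂.MMinus z k₀ ∧ J₁.MPlus z k₀ = J₂.MPlus z k₀ := by
    filter_upwards [him, hl.eventually_ge_atTop (contFracRadius J₁.bound)] with z hz hz'
    exact JacobiCoeffs.MMinus_MPlus_eq_of_weylM_eq hz' (hM z hz)
  obtain rfl := JacobiCoeffs.eq_of_MMinus_MPlus_eventuallyEq hl (h.mono fun _ h => h.1)
    (h.mono fun _ h => h.2)
  exact ⟨rfl, fun _ => rfl, fun _ => rfl⟩
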